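/- Let $\mathcal K$ be a field and let $\Delta$ be a simplicial complex on a finite nonempty vertex set $V$, every vertex being a face. For each facet $F$ of $\Delta$ choose a vertex $x_0\in F$ and a (possibly empty) list $\langle x_0,x_1\rangle,\dots,\langle x_0,x_k\rangle$ of distinct edges of $F$ that are contained in no other facet of $\Delta$, and attach to each edge $\langle x_0,x_j\rangle$ finitely many (possibly zero) new points $y_{j,1},\dots,y_{j,n_j}$; all new points, for all edges and all facets, are distinct and do not lie in $V$. (The data $x_0$, $k$, $x_j$, $n_j$, $y_{j,m}$ depend on $F$.) Let $Y_F$ be the set of the new points attached to $F$. The extension complex $\overline{\Delta}$ is the simplicial complex on the vertex set $V_{\overline\Delta}=V\cup\bigcup_F Y_F$ whose facets are the sets $F\cup Y_F$, for $F$ a facet of $\Delta$. Let $\mathcal I_F\subset \mathcal K[V_{\overline\Delta}]$ be the ideal generated by the $2\times2$ minors of the matrix $$M_F=\left(\begin{array}{cccc|ccc|c|ccc} x_0&y_{1,1}&\cdots&y_{1,n_1}&y_{2,1}&\cdots&y_{2,n_2}&\cdots&y_{k,1}&\cdots&y_{k,n_k}\\ y_{1,1}&y_{1,2}&\cdots&x_1&y_{2,2}&\cdots&x_2&\cdots&y_{k,2}&\cdots&x_k\end{array}\right),$$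 where the first block has $n_1+1$ columns and, for $j\ge2$, the $j$-th block has $n_j$ columns (so $\mathcal I_F=0$ if $Y_F=\emptyset$). Let $\mathcal B_{\overline\Delta}=\sum_F\mathcal I_F+\mathcal I_{\overline\Delta}$, where $F$ runs over the facets of $\Delta$ and $\mathcal I_{\overline\Delta}$ is the Stanley–Reisner ideal of $\overline\Delta$, generated by the squarefree monomials whose support is not a face of $\overline\Delta$. Then the Krull dimension of $\mathcal K[V_{\overline\Delta}]/\mathcal B_{\overline\Delta}$ is $$\dim\bigl(\mathcal K[V_{\overline\Delta}]/\mathcal B_{\overline\Delta}\bigr)=1+\dim\Delta=1+\max_F d_F,$$ where $d_F=|F|-1$ is the dimension of the facet $F$ of $\Delta$, the new points not being counted. -/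

import Mathlib

namespace AbstractSimplicialComplex

/-- The dimension of a simplicial complex: the maximal dimension `|F| - 1` of a face `F`
(all faces in `AbstractSimplicialComplex` are nonempty, the empty face being left out). -/
noncomputable def dim {V : Type*} (Δ : AbstractSimplicialComplex V) : ℕ∞ :=
  ⨆ F ∈ Δ.faces, ((F.card - 1 : ℕ) : ℕ∞)

/-- The facets of a simplicial complex: its inclusion-maximal faces. -/
def Facet {V : Type*} (Δ : AbstractSimplicialComplex V) : Type _ :=
  {F : Finset V // Maximal (fun S => S ∈ Δ.faces) F}

/-- On a finite vertex set, every vertex lies on a facet. -/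
theorem exists_facet_mem {V : Type*} [Finite V] (Δ : AbstractSimplicialComplex V) (v : V) :
    ∃ F : Δ.Facet, v ∈ F.1 := by
  obtain ⟨F, hle, hF⟩ := (Set.toFinite Δ.faces).exists_le_maximal (Δ.singleton_mem v)
  exact ⟨⟨F, hF⟩, hle (Finset.mem_singleton_self v)⟩

/-- The Stanley-Reisner ideal of `Δ`, generated by the squarefree monomials whose support is not
a face. (The empty set counts as a face.) -/
noncomputable def stanleyReisnerIdeal (K : Type*) [Field K] {V : Type*}
    (Δ : AbstractSimplicialComplex V) : Ideal (MvPolynomial V K) :=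
  Ideal.span {p | ∃ S : Finset V, S.Nonempty ∧ S ∉ Δ.faces ∧ p = ∏ v ∈ S, MvPolynomial.X v}

/-- The choices from which an extension complex of `Δ` is built. For each facet `F` we choose an
origin `x₀ ∈ F`, a (possibly empty) list `⟨x₀, x₁⟩, …, ⟨x₀, xₖ⟩` of edges of `F` which belong to
no facet other than `F` (the proper edges), and, for each of these proper edges, a number `≥ 0`
of new points. A facet that is not proper has `numEdges F = 0`, and its origin plays no role. -/
structure ExtensionData {V : Type*} (Δ : AbstractSimplicialComplex V) where
  numEdges : Δ.Facet → ℕ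
  origin : Δ.Facet → V
  tip : (F : Δ.Facet) → Fin (numEdges F) → V
  numPoints : (F : Δ.Facet) → Fin (numEdges F) → ℕ
  origin_mem : ∀ F, origin F ∈ F.1
  tip_mem : ∀ F j, tip F j ∈ F.1
  tip_ne_origin : ∀ F j, tip F j ≠ origin F
  tip_injective : ∀ F, Function.Injective (tip F)
  proper : ∀ F j (G : Δ.Facet), origin F ∈ G.1 → tip F j ∈ G.1 → G = F

namespace ExtensionData

variable {V : Type*} {Δ : AbstractSimplicialComplex V}

/-- The new points `y` attached to the facet `F`: the pair `⟨j, m⟩` is the `m`-th new point on the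
`j`-th proper edge of `F` (both counted from `0`). -/
abbrev NewPoint (E : ExtensionData Δ) (F : Δ.Facet) : Type :=
  Σ j : Fin (E.numEdges F), Fin (E.numPoints F j)

/-- The vertex set of the extension complex: the vertices of `Δ` and all the new points. -/
abbrev Vertex (E : ExtensionData Δ) : Type _ :=
  V ⊕ (Σ F : Δ.Facet, E.NewPoint F)

/-- The extension of the facet `F`: its vertices together with all new points attached to it. -/
def extFacet (E : ExtensionData Δ) (F : Δ.Facet) : Set E.Vertex :=
  Sum.inl '' (F.1 : Set V) ∪ Set.range (fun y : E.NewPoint F => Sum.inr ⟨F, y⟩)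

/-- The extension complex: the faces are the nonempty subsets of the extended facets. -/
def extComplex [Finite V] (E : ExtensionData Δ) : AbstractSimplicialComplex E.Vertex where
  faces := {S | S.Nonempty ∧ ∃ F : Δ.Facet, (S : Set E.Vertex) ⊆ E.extFacet F}
  isRelLowerSet_faces := by
    rintro S ⟨hS, F, hF⟩
    refine ⟨hS, fun T hT hne => ⟨hne, F, ?_⟩⟩
    exact (Finset.coe_subset.mpr hT).trans hF
  singleton_mem := by
    rintro (v | ⟨F, y⟩)
    · obtain ⟨F, hF⟩ := Δ.exists_facet_mem v
      exact ⟨Finset.singleton_nonempty _, F, by simpa [extFacet] using hF⟩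
    · exact ⟨Finset.singleton_nonempty _, F, by simp [extFacet]⟩

/-- The new points of the `j`-th proper edge of `F` followed by the tip of that edge:
`y₀, y₁, …, yₙ₋₁, xⱼ` (then constantly `xⱼ`). -/
def tailSeq (E : ExtensionData Δ) (F : Δ.Facet) (j : Fin (E.numEdges F)) (i : ℕ) : E.Vertex :=
  if h : i < E.numPoints F j then Sum.inr ⟨F, j, i, h⟩ else Sum.inl (E.tip F j)

/-- The sequence of vertices in the `j`-th block of the scroll matrix of `F`: the first block uses
`x₀, y₀, …, yₙ₋₁, x₁`, the other blocks use `y₀, …, yₙ₋₁, xⱼ`. -/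
def blockSeq (E : ExtensionData Δ) (F : Δ.Facet) (j : Fin (E.numEdges F)) (i : ℕ) : E.Vertex :=
  if j.val = 0 then
    match i with
    | 0 => Sum.inl (E.origin F)
    | i + 1 => E.tailSeq F j i
  else E.tailSeq F j i

/-- The number of columns of the `j`-th block: one less than the length of its sequence. -/
def blockWidth (E : ExtensionData Δ) (F : Δ.Facet) (j : Fin (E.numEdges F)) : ℕ :=
  if j.val = 0 then E.numPoints F j + 1 else E.numPoints F j

/-- The scroll matrix of `F`: column `c` of block `j` consists of the `c`-th and the `(c+1)`-st
term of the sequence of that block. -/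
noncomputable def scrollMatrix (K : Type*) [Field K] (E : ExtensionData Δ) (F : Δ.Facet) :
    Matrix (Fin 2) (Σ j : Fin (E.numEdges F), Fin (E.blockWidth F j))
      (MvPolynomial E.Vertex K) :=
  fun r c => MvPolynomial.X (E.blockSeq F c.1 (c.2.val + r.val))

/-- The ideal of the facet `F`: generated by the `2 × 2` minors of its scroll matrix. If no new
point is attached to `F`, the matrix has at most one column, and the ideal is zero. -/
noncomputable def scrollIdeal (K : Type*) [Field K] (E : ExtensionData Δ) (F : Δ.Facet) :
    Ideal (MvPolynomial E.Vertex K) :=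
  Ideal.span {p | ∃ c₁ c₂, p = ((E.scrollMatrix K F).submatrix id ![c₁, c₂]).det}

/-- The binomial extension ideal: the sum of the ideals of all facets and of the Stanley-Reisner
ideal of the extension complex. -/
noncomputable def binomialIdeal (K : Type*) [Field K] [Finite V] (E : ExtensionData Δ) :
    Ideal (MvPolynomial E.Vertex K) :=
  (⨆ F : Δ.Facet, E.scrollIdeal K F) ⊔ E.extComplex.stanleyReisnerIdeal K

end ExtensionData

end AbstractSimplicialComplex

/-! The dimension is read off from points with values in extension fields of `K`. At a zero of the
ideal the support lies in one extended facet `F`, and the scroll matrix of `F` has rank at most one.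
Upper bound (`IsZero.exists_finite_forall_isAlgebraic`): take the generic point of a prime. If the
top row vanishes, so do all new points, and the coordinates at `F` suffice. Otherwise the bottom row
is `t` times the top row, so each block is a geometric progression. All coordinates are then
algebraic over `|F|` elements: `t` replaces the first tip, and the head of each later block replaces
its tip. Lower bound (`exists_isZero_and_algebraicIndependent`): independent values on `F` extend to
a zero by solving for `t` and the new points. Properness of the edges kills the minors of the other
facets. -/

/-! ### Krull dimension and transcendence degree -/

theorem ringKrullDim_eq_of_isIntegral (R S : Type*) [CommRing R] [CommRing S] [Algebra R S]
    [Algebra.IsIntegral R S] [FaithfulSMul R S] : ringKrullDim S = ringKrullDim R := by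
  refine le_antisymm ?_ ?_
  · exact Order.krullDim_le_of_strictMono (PrimeSpectrum.comap (algebraMap R S))
      fun P Q h => Ideal.IsIntegral.comap_lt_comap (R := R) (I := P.asIdeal) (J := Q.asIdeal) h
  · refine iSup_le fun l => ?_
    obtain ⟨P, hP, hP'⟩ := Ideal.nonempty_primesOver (S := S) (RelSeries.head l).asIdeal
    obtain ⟨m, hm, -, -⟩ := Ideal.exists_ltSeries_of_hasGoingUp l P
    rw [← hm]
    exact Order.LTSeries.length_le_krullDim m

/-- The Krull dimension of a finitely generated domain over a field is its transcendence degree. -/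
theorem exists_ringKrullDim_eq_and_trdeg_eq (k A : Type*) [Field k] [CommRing A] [IsDomain A]
    [Algebra k A] [Algebra.FiniteType k A] :
    ∃ n : ℕ, ringKrullDim A = n ∧ Algebra.trdeg k A = n := by
  obtain ⟨n, g, hinj, hint⟩ := exists_integral_inj_algHom_of_fg k A
  let _ : Algebra (MvPolynomial (Fin n) k) A := g.toRingHom.toAlgebra
  have : IsScalarTower k (MvPolynomial (Fin n) k) A :=
    IsScalarTower.of_algebraMap_eq fun x => (g.commutes x).symm
  have : Algebra.IsIntegral (MvPolynomial (Fin n) k) A := ⟨hint⟩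
  have : FaithfulSMul (MvPolynomial (Fin n) k) A :=
    (faithfulSMul_iff_algebraMap_injective _ _).mpr hinj
  refine ⟨n, ?_, ?_⟩
  · rw [ringKrullDim_eq_of_isIntegral (MvPolynomial (Fin n) k) A,
      MvPolynomial.ringKrullDim_of_isNoetherianRing]
    simp
  · have h := ((IsTranscendenceBasis.mvPolynomial (Fin n) k).algebraMap_comp
      (A := A)).lift_cardinalMk_eq_trdeg
    simpa using h.symm

theorem ringKrullDim_le_of_forall_quotient_prime {R : Type*} [CommRing R] {n : WithBot ℕ∞}
    (h : ∀ P : Ideal R, P.IsPrime → ringKrullDim (R ⧸ P) ≤ n) : ringKrullDim R ≤ n := by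
  rw [ringKrullDim, Order.krullDim_eq_iSup_coheight]
  refine iSup_le fun P => ?_
  have hP := h P.asIdeal P.2
  rw [ringKrullDim_quotient] at hP
  rw [Order.coheight_eq_krullDim_Ici]
  have hIci : Set.Ici P = PrimeSpectrum.zeroLocus (P.asIdeal : Set R) := by
    ext Q
    exact Iff.rfl
  rwa [hIci]

theorem natCast_le_ringKrullDim_of_algebraicIndependent {k A ι : Type*} [Field k] [CommRing A]
    [IsDomain A] [Algebra k A] [Algebra.FiniteType k A] [Finite ι] {x : ι → A}
    (hx : AlgebraicIndependent k x) : (Nat.card ι : WithBot ℕ∞) ≤ ringKrullDim A := by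
  obtain ⟨n, hdim, htr⟩ := exists_ringKrullDim_eq_and_trdeg_eq k A
  have h := hx.lift_cardinalMk_le_trdeg
  rw [htr, ← Nat.cast_card] at h
  rw [hdim]
  simpa using h

/-- Algebraic elements are closed under sums, products and inverses, so checking generators of `A`
makes all of `L` algebraic over `k[T]`. This bounds the transcendence degree by `|T|`. -/
theorem ringKrullDim_le_ncard_of_forall_isAlgebraic {k A L : Type*} [Field k] [CommRing A]
    [IsDomain A] [Algebra k A] [Algebra.FiniteType k A] [Field L] [Algebra k L] [Algebra A L]
    [IsScalarTower k A L] [IsFractionRing A L] {s : Set A} (hs : Algebra.adjoin k s = ⊤)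
    {T : Set L} (hT : T.Finite)
    (h : ∀ x ∈ s, IsAlgebraic (Algebra.adjoin k T) (algebraMap A L x)) :
    ringKrullDim A ≤ (T.ncard : WithBot ℕ∞) := by
  obtain ⟨n, hdim, htr⟩ := exists_ringKrullDim_eq_and_trdeg_eq k A
  have hA (x : A) : IsAlgebraic (Algebra.adjoin k T) (algebraMap A L x) := by
    have hx : x ∈ Algebra.adjoin k s := hs ▸ Algebra.mem_top
    induction hx using Algebra.adjoin_induction with
    | mem x hx => exact h x hx
    | algebraMap r =>
      rw [← IsScalarTower.algebraMap_apply,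
        IsScalarTower.algebraMap_apply k (Algebra.adjoin k T) L]
      exact isAlgebraic_algebraMap _
    | add x y _ _ hx hy => rw [map_add]; exact hx.add hy
    | mul x y _ _ hx hy => rw [map_mul]; exact hx.mul hy
  have : Algebra.IsAlgebraic (Algebra.adjoin k T) L := ⟨fun y => by
    obtain ⟨a, b, -, rfl⟩ := IsFractionRing.div_surjective A y
    rw [div_eq_mul_inv]
    exact (hA a).mul (hA b).inv⟩
  have h₁ := lift_trdeg_le_of_injective (IsScalarTower.toAlgHom k A L)
    (IsFractionRing.injective A L)
  have h₂ := Algebra.IsAlgebraic.trdeg_le_cardinalMk k T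
  have := hT.to_subtype
  rw [← Nat.cast_card, Nat.card_coe_set_eq] at h₂
  have h₃ := h₁.trans (Cardinal.lift_le.mpr h₂)
  rw [htr] at h₃
  rw [hdim]
  simpa using h₃

universe u v

namespace AbstractSimplicialComplex

instance {V : Type*} [Finite V] (Δ : AbstractSimplicialComplex V) : Finite Δ.Facet :=
  inferInstanceAs (Finite {F : Finset V // Maximal (fun S => S ∈ Δ.faces) F})

namespace ExtensionData

variable {V : Type v} {Δ : AbstractSimplicialComplex V} (E : ExtensionData Δ)

/-! ### Zeros of the binomial extension ideal -/

theorem blockSeq_blockWidth (F : Δ.Facet) (j : Fin (E.numEdges F)) :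
    E.blockSeq F j (E.blockWidth F j) = Sum.inl (E.tip F j) := by
  unfold blockSeq blockWidth
  split_ifs <;> simp [tailSeq]

theorem blockSeq_zero_of_val_eq_zero {F : Δ.Facet} {j : Fin (E.numEdges F)} (hj : j.val = 0) :
    E.blockSeq F j 0 = Sum.inl (E.origin F) := by
  simp [blockSeq, hj]

theorem exists_blockSeq_eq_newPoint (F : Δ.Facet) (y : E.NewPoint F) :
    ∃ c : Fin (E.blockWidth F y.1), E.blockSeq F y.1 c = Sum.inr ⟨F, y⟩ := by
  obtain ⟨j, m⟩ := y
  by_cases hj : j.val = 0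
  · exact ⟨⟨m + 1, by simp [blockWidth, hj]⟩, by simp [blockSeq, hj, tailSeq]⟩
  · exact ⟨⟨m, by simp [blockWidth, hj]⟩, by simp [blockSeq, hj, tailSeq]⟩

/-- The entry in the top row of a column is the origin or a new point. -/
theorem blockSeq_eq_origin_or_newPoint {F : Δ.Facet} {j : Fin (E.numEdges F)} {i : ℕ}
    (hi : i < E.blockWidth F j) :
    E.blockSeq F j i = Sum.inl (E.origin F) ∨ ∃ y, E.blockSeq F j i = Sum.inr ⟨F, y⟩ := by
  by_cases hj : j.val = 0
  · rcases i with - | i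
    · exact .inl (E.blockSeq_zero_of_val_eq_zero hj)
    · have : i < E.numPoints F j := by simpa [blockWidth, hj] using hi
      exact .inr ⟨⟨j, i, this⟩, by simp [blockSeq, hj, tailSeq, this]⟩
  · have : i < E.numPoints F j := by simpa [blockWidth, hj] using hi
    exact .inr ⟨⟨j, i, this⟩, by simp [blockSeq, hj, tailSeq, this]⟩

/-- The entry in the bottom row of a column is a tip or a new point. -/
theorem blockSeq_succ_eq_tip_or_newPoint (F : Δ.Facet) (j : Fin (E.numEdges F)) (i : ℕ) :
    E.blockSeq F j (i + 1) = Sum.inl (E.tip F j) ∨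
      ∃ y, E.blockSeq F j (i + 1) = Sum.inr ⟨F, y⟩ := by
  have h (i : ℕ) : E.tailSeq F j i = Sum.inl (E.tip F j) ∨
      ∃ y, E.tailSeq F j i = Sum.inr ⟨F, y⟩ := by
    unfold tailSeq
    split_ifs with h
    · exact .inr ⟨_, rfl⟩
    · exact .inl rfl
  unfold blockSeq
  split_ifs
  · exact h i
  · exact h (i + 1)

theorem det_scrollMatrix_submatrix (K : Type*) [Field K] (F : Δ.Facet)
    (c₁ c₂ : Σ j : Fin (E.numEdges F), Fin (E.blockWidth F j)) :
    ((E.scrollMatrix K F).submatrix id ![c₁, c₂]).det =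
      MvPolynomial.X (E.blockSeq F c₁.1 c₁.2) * MvPolynomial.X (E.blockSeq F c₂.1 (c₂.2 + 1)) -
      MvPolynomial.X (E.blockSeq F c₂.1 c₂.2) * MvPolynomial.X (E.blockSeq F c₁.1 (c₁.2 + 1)) := by
  simp [Matrix.det_fin_two, scrollMatrix]

/-- The points at which all generators of the binomial extension ideal vanish. -/
structure IsZero {L : Type*} [Field L] (a : E.Vertex → L) : Prop where
  minor : ∀ (F : Δ.Facet) (c₁ c₂ : Σ j : Fin (E.numEdges F), Fin (E.blockWidth F j)),
    a (E.blockSeq F c₁.1 c₁.2) * a (E.blockSeq F c₂.1 (c₂.2 + 1)) =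
      a (E.blockSeq F c₂.1 c₂.2) * a (E.blockSeq F c₁.1 (c₁.2 + 1))
  support : ∃ F : Δ.Facet, ∀ v, a v ≠ 0 → v ∈ E.extFacet F

theorem binomialIdeal_le_ker_aeval_iff [Finite V] [Nonempty V] {K L : Type*} [Field K] [Field L]
    [Algebra K L] (a : E.Vertex → L) :
    E.binomialIdeal K ≤ RingHom.ker (MvPolynomial.aeval (R := K) a) ↔ E.IsZero a := by
  simp only [binomialIdeal, sup_le_iff, iSup_le_iff, scrollIdeal, stanleyReisnerIdeal,
    Ideal.span_le]
  refine ⟨fun ⟨h₁, h₂⟩ => ⟨fun F c₁ c₂ => ?_, ?_⟩, fun h => ⟨?_, ?_⟩⟩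
  · have h := h₁ F ⟨c₁, c₂, rfl⟩
    rw [det_scrollMatrix_submatrix] at h
    simpa [sub_eq_zero] using h
  · classical
    have : Fintype E.Vertex := Fintype.ofFinite _
    let S : Finset E.Vertex := {v | a v ≠ 0}
    suffices ∃ F : Δ.Facet, (S : Set E.Vertex) ⊆ E.extFacet F by
      obtain ⟨F, hF⟩ := this
      exact ⟨F, fun v hv => hF (by simpa [S] using hv)⟩
    -- The monomial of the support of `a` is nonzero at `a`, so a nonempty support is a face. For
    -- empty support any facet will do.
    rcases S.eq_empty_or_nonempty with hS | hS
    · obtain ⟨F, -⟩ := Δ.exists_facet_mem (Classical.arbitrary V)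
      exact ⟨F, by simp [hS]⟩
    · by_contra hF
      have h := h₂ ⟨S, hS, fun hS' => hF hS'.2, rfl⟩
      simp [Finset.prod_eq_zero_iff, S] at h
  · rintro F _ ⟨c₁, c₂, rfl⟩
    rw [det_scrollMatrix_submatrix]
    simpa [sub_eq_zero] using h.minor F c₁ c₂
  · rintro _ ⟨S, hS, hS', rfl⟩
    obtain ⟨F, hF⟩ := h.support
    obtain ⟨v, hv, hv'⟩ : ∃ v ∈ S, v ∉ E.extFacet F := by
      by_contra! hSF
      exact hS' ⟨hS, F, hSF⟩
    have : a v = 0 := by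
      by_contra hav
      exact hv' (hF v hav)
    rw [SetLike.mem_coe, RingHom.mem_ker, map_prod]
    exact Finset.prod_eq_zero hv (by simpa using this)

/-! ### Upper bound: few coordinates control a zero -/

/-- If the bottom row of the scroll matrix of `F` is `t` times the top row, the entries of the
matrix are monomials in `t` and the first terms of the blocks. -/
theorem apply_blockSeq_eq_pow_mul {L : Type*} [Field L] {a : E.Vertex → L} {F : Δ.Facet} {t : L}
    (h : ∀ (j : Fin (E.numEdges F)) (i : ℕ), i < E.blockWidth F j →
      a (E.blockSeq F j (i + 1)) = t * a (E.blockSeq F j i))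
    (j : Fin (E.numEdges F)) (i : ℕ) (hi : i ≤ E.blockWidth F j) :
    a (E.blockSeq F j i) = t ^ i * a (E.blockSeq F j 0) := by
  induction i with
  | zero => simp
  | succ i ih => rw [h j i hi, ih (by omega), pow_succ']; ring

theorem IsZero.exists_finite_forall_isAlgebraic {K L : Type*} [Field K] [Field L] [Algebra K L]
    {a : E.Vertex → L} (ha : E.IsZero a) : ∃ (F : Δ.Facet) (T : Set L), T.Finite ∧
      T.ncard ≤ F.1.card ∧ ∀ v, IsAlgebraic (Algebra.adjoin K T) (a v) := by
  classical
  obtain ⟨F, hF⟩ := ha.support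
  suffices ∃ z : V → L, (∀ v ∈ F.1, IsAlgebraic (Algebra.adjoin K (z '' F.1)) (a (Sum.inl v))) ∧
      ∀ y, IsAlgebraic (Algebra.adjoin K (z '' F.1)) (a (Sum.inr ⟨F, y⟩)) by
    obtain ⟨z, hz, hz'⟩ := this
    refine ⟨F, z '' F.1, F.1.finite_toSet.image z, ?_, fun v => ?_⟩
    · exact (Set.ncard_image_le F.1.finite_toSet).trans (Set.ncard_coe_finset F.1).le
    · by_cases hv : a v = 0
      · rw [hv]
        exact isAlgebraic_zero
      · rcases hF v hv with ⟨w, hw, rfl⟩ | ⟨y, rfl⟩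
        · exact hz w hw
        · exact hz' y
  have hmem (z : V → L) {v : V} (hv : v ∈ F.1) :
      IsAlgebraic (Algebra.adjoin K (z '' F.1)) (z v) :=
    isAlgebraic_algebraMap
      (⟨z v, Algebra.subset_adjoin ⟨v, hv, rfl⟩⟩ : Algebra.adjoin K (z '' F.1))
  by_cases htop : ∀ (j : Fin (E.numEdges F)) (c : Fin (E.blockWidth F j)),
      a (E.blockSeq F j c) = 0
  -- Every new point of `F` occurs in the top row, hence vanishes here.
  · refine ⟨fun v => a (Sum.inl v), fun v hv => hmem (fun v => a (Sum.inl v)) hv, fun y => ?_⟩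
    obtain ⟨c, hc⟩ := E.exists_blockSeq_eq_newPoint F y
    rw [← hc, htop]
    exact isAlgebraic_zero
  push Not at htop
  obtain ⟨j₀, c₀, hne⟩ := htop
  set t : L := a (E.blockSeq F j₀ (c₀ + 1)) / a (E.blockSeq F j₀ c₀) with ht
  have hstep (j : Fin (E.numEdges F)) (i : ℕ) (hi : i < E.blockWidth F j) :
      a (E.blockSeq F j (i + 1)) = t * a (E.blockSeq F j i) := by
    have := ha.minor F ⟨j₀, c₀⟩ ⟨j, i, hi⟩
    rw [ht]
    field_simp
    linear_combination this
  have hpow := E.apply_blockSeq_eq_pow_mul hstep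
  -- One parameter per vertex of `F`: the first tip is traded for `t`, a later tip for the head of
  -- its block. The origin is no tip and keeps its value, which is the head of the first block.
  let z : V → L := fun v => if h : ∃ j, E.tip F j = v then
    (if h.choose.val = 0 then t else a (E.blockSeq F h.choose 0)) else a (Sum.inl v)
  have hz_tip (j : Fin (E.numEdges F)) :
      z (E.tip F j) = if j.val = 0 then t else a (E.blockSeq F j 0) := by
    have h : ∃ j', E.tip F j' = E.tip F j := ⟨j, rfl⟩
    have hj : h.choose = j := E.tip_injective F h.choose_spec
    simp only [z, dif_pos h, hj]
  have hz_of_ne {v : V} (hv : ∀ j, E.tip F j ≠ v) : z v = a (Sum.inl v) :=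
    dif_neg (by simpa using hv)
  have hzt : IsAlgebraic (Algebra.adjoin K (z '' F.1)) t := by
    have hpos : 0 < E.numEdges F := j₀.pos
    have := hmem z (E.tip_mem F ⟨0, hpos⟩)
    rwa [hz_tip, if_pos rfl] at this
  have hhead (j : Fin (E.numEdges F)) :
      IsAlgebraic (Algebra.adjoin K (z '' F.1)) (a (E.blockSeq F j 0)) := by
    by_cases hj : j.val = 0
    · rw [E.blockSeq_zero_of_val_eq_zero hj, ← hz_of_ne (E.tip_ne_origin F)]
      exact hmem z (E.origin_mem F)
    · have := hmem z (E.tip_mem F j)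
      rwa [hz_tip, if_neg hj] at this
  have hblock (j : Fin (E.numEdges F)) (i : ℕ) (hi : i ≤ E.blockWidth F j) :
      IsAlgebraic (Algebra.adjoin K (z '' F.1)) (a (E.blockSeq F j i)) := by
    rw [hpow j i hi]
    exact (hzt.pow i).mul (hhead j)
  refine ⟨z, fun v hv => ?_, fun y => ?_⟩
  · by_cases htip : ∃ j, E.tip F j = v
    · obtain ⟨j, rfl⟩ := htip
      rw [← E.blockSeq_blockWidth]
      exact hblock j _ le_rfl
    · rw [← hz_of_ne (by simpa using htip)]
      exact hmem z hv
  · obtain ⟨c, hc⟩ := E.exists_blockSeq_eq_newPoint F y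
    rw [← hc]
    exact hblock _ _ c.2.le

/-! ### Lower bound: a zero with independent coordinates on a facet -/

/-- For `G ≠ F`, each term of a minor of `G` contains a new point of `G` or the product of the
origin and a tip of `G`. New points of `G` vanish off `F`, and by properness `F` cannot contain both
ends of the edge. -/
theorem isZero_of_forall_eq_mul {L : Type*} [Field L] {a : E.Vertex → L} {F : Δ.Facet} (t : L)
    (hF : ∀ v, a v ≠ 0 → v ∈ E.extFacet F)
    (h : ∀ (j : Fin (E.numEdges F)) (i : ℕ), i < E.blockWidth F j →
      a (E.blockSeq F j (i + 1)) = t * a (E.blockSeq F j i)) : E.IsZero a where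
  support := ⟨F, hF⟩
  minor G c₁ c₂ := by
    by_cases hG : G = F
    · subst hG
      rw [h _ _ c₁.2.2, h _ _ c₂.2.2]
      ring
    · have hinl {v : V} (hv : v ∉ F.1) : a (Sum.inl v) = 0 := by
        by_contra hne
        have := hF _ hne
        simp [extFacet, hv] at this
      have hinr (y : E.NewPoint G) : a (Sum.inr ⟨G, y⟩) = 0 := by
        by_contra hne
        rcases hF _ hne with ⟨w, -, hw⟩ | ⟨y', hy'⟩
        · cases hw
        · exact hG (congrArg Sigma.fst (Sum.inr_injective hy')).symm
      have hzero (c c' : Σ j : Fin (E.numEdges G), Fin (E.blockWidth G j)) :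
          a (E.blockSeq G c.1 c.2) * a (E.blockSeq G c'.1 (c'.2 + 1)) = 0 := by
        rcases E.blockSeq_eq_origin_or_newPoint c.2.2 with h₁ | ⟨y, h₁⟩
        · rcases E.blockSeq_succ_eq_tip_or_newPoint G c'.1 c'.2 with h₂ | ⟨y, h₂⟩
          · rw [h₁, h₂]
            by_cases ho : E.origin G ∈ F.1
            · rw [hinl fun ht => hG (E.proper G c'.1 F ho ht).symm, mul_zero]
            · rw [hinl ho, zero_mul]
          · rw [h₂, hinr, mul_zero]
        · rw [h₁, hinr, zero_mul]
      rw [hzero, hzero]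

/-- The variety of the extension complex has a component on which the vertices of a given facet are
independent coordinates. -/
theorem exists_isZero_and_algebraicIndependent (K : Type u) [Field K] (F : Δ.Facet) :
    ∃ (L : Type max u v) (_ : Field L) (_ : Algebra K L) (a : E.Vertex → L), E.IsZero a ∧
      AlgebraicIndependent K fun v : F.1 => a (Sum.inl v.1) := by
  classical
  let L := AlgebraicClosure (FractionRing (MvPolynomial V K))
  let x : V → L := fun v => algebraMap (MvPolynomial V K) L (MvPolynomial.X v)
  have hinj : Function.Injective (algebraMap (MvPolynomial V K) L) := by
    rw [IsScalarTower.algebraMap_eq _ (FractionRing (MvPolynomial V K)) L]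
    exact (algebraMap (FractionRing (MvPolynomial V K)) L).injective.comp (IsFractionRing.injective _ _)
  have hx : AlgebraicIndependent K x :=
    (MvPolynomial.algebraicIndependent_X V K).map' (f := IsScalarTower.toAlgHom K _ L) hinj
  have hx0 (v : V) : x v ≠ 0 := hx.ne_zero v
  -- Only the first block has both ends prescribed: `n₁ + 1` steps lead from `x₀` to `x₁`, which
  -- forces a root. The other blocks are filled backwards from their tips, dividing by `t`.
  obtain ⟨t, ht0, ht⟩ : ∃ t : L, t ≠ 0 ∧ ∀ j : Fin (E.numEdges F), j.val = 0 →
      t ^ (E.numPoints F j + 1) * x (E.origin F) = x (E.tip F j) := by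
    by_cases hpos : 0 < E.numEdges F
    · obtain ⟨t, ht⟩ := IsAlgClosed.exists_pow_nat_eq
        (x (E.tip F ⟨0, hpos⟩) / x (E.origin F)) (E.numPoints F ⟨0, hpos⟩).succ_pos
      refine ⟨t, ?_, fun j hj => ?_⟩
      · rintro rfl
        rw [zero_pow (Nat.succ_ne_zero _)] at ht
        exact div_ne_zero (hx0 _) (hx0 _) ht.symm
      · obtain rfl : j = ⟨0, hpos⟩ := Fin.ext hj
        rw [ht, div_mul_cancel₀ _ (hx0 _)]
    · exact ⟨1, one_ne_zero, fun j => absurd j.pos hpos⟩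
  let a : E.Vertex → L := Sum.elim (fun v => if v ∈ F.1 then x v else 0) fun y =>
    if y.1 = F then
      if y.2.1.val = 0 then t ^ (y.2.2.val + 1) * x (E.origin y.1)
      else x (E.tip y.1 y.2.1) / t ^ (E.numPoints y.1 y.2.1 - y.2.2)
    else 0
  have ha_inl {v : V} (hv : v ∈ F.1) : a (Sum.inl v) = x v := if_pos hv
  refine ⟨L, inferInstance, inferInstance, a, E.isZero_of_forall_eq_mul t (F := F) ?_ ?_, ?_⟩
  · rintro (v | ⟨G, y⟩) hne
    · by_cases hv : v ∈ F.1
      · exact .inl ⟨v, hv, rfl⟩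
      · exact absurd (if_neg hv) hne
    · by_cases hG : G = F
      · subst hG
        exact .inr ⟨y, rfl⟩
      · exact absurd (if_neg hG) hne
  · intro j
    by_cases hj : j.val = 0
    · have key (i : ℕ) (hi : i ≤ E.blockWidth F j) :
          a (E.blockSeq F j i) = t ^ i * x (E.origin F) := by
        rcases i with - | i
        · rw [E.blockSeq_zero_of_val_eq_zero hj, ha_inl (E.origin_mem F), pow_zero, one_mul]
        · simp only [blockSeq, hj, if_true, tailSeq]
          split_ifs with h
          · simp [a, hj]
          · obtain rfl : i = E.numPoints F j := by
              simp only [blockWidth, hj, if_true] at hi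
              omega
            rw [ha_inl (E.tip_mem F j), ht j hj]
      intro i hi
      rw [key _ hi, key _ hi.le, pow_succ']
      ring
    -- No bound on `i` is needed: past the tip the sequence is constant and the truncated exponent
    -- is `0`.
    · have key (i : ℕ) : a (E.blockSeq F j i) = x (E.tip F j) / t ^ (E.numPoints F j - i) := by
        simp only [blockSeq, hj, if_false, tailSeq]
        split_ifs with h
        · simp [a, hj]
        · rw [ha_inl (E.tip_mem F j), Nat.sub_eq_zero_of_le (not_lt.mp h), pow_zero, div_one]
      intro i hi
      have hi' : i < E.numPoints F j := by simpa [blockWidth, hj] using hi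
      rw [key, key, show E.numPoints F j - i = E.numPoints F j - (i + 1) + 1 by omega, pow_succ',
        mul_div_assoc', mul_div_mul_left _ _ ht0]
  · have : (fun v : F.1 => a (Sum.inl v.1)) = fun v : F.1 => x v.1 :=
      funext fun v => ha_inl v.2
    rw [this]
    exact hx.comp _ Subtype.val_injective

/-! ### From zeros to the Krull dimension -/

theorem card_le_ringKrullDim [Finite V] [Nonempty V] (K : Type u) [Field K] (F : Δ.Facet) :
    (F.1.card : WithBot ℕ∞) ≤ ringKrullDim (MvPolynomial E.Vertex K ⧸ E.binomialIdeal K) := by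
  obtain ⟨L, _, _, a, ha, hind⟩ := E.exists_isZero_and_algebraicIndependent K F
  let φ : (MvPolynomial E.Vertex K ⧸ E.binomialIdeal K) →ₐ[K] L :=
    Ideal.Quotient.liftₐ _ (MvPolynomial.aeval a)
      fun p hp => (E.binomialIdeal_le_ker_aeval_iff a).mpr ha hp
  have hφ (v : E.Vertex) : φ (Ideal.Quotient.mk _ (MvPolynomial.X v)) = a v :=
    MvPolynomial.aeval_X a v
  have : Algebra.FiniteType K φ.range :=
    .of_surjective φ.rangeRestrict φ.rangeRestrict_surjective
  have hind' : AlgebraicIndependent K fun v : F.1 => (⟨a (Sum.inl v.1), _, hφ _⟩ : φ.range) :=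
    .of_comp φ.range.val hind
  -- The image of `φ` is a finitely generated domain, being a subring of `L`, and a quotient of the
  -- ring in question.
  have h := natCast_le_ringKrullDim_of_algebraicIndependent hind'
  rw [Nat.card_eq_fintype_card, Fintype.card_coe] at h
  exact h.trans (ringKrullDim_le_of_surjective φ.rangeRestrict.toRingHom
    φ.rangeRestrict_surjective)

theorem ringKrullDim_le [Finite V] [Nonempty V] (K : Type*) [Field K] {n : ℕ}
    (hn : ∀ F : Δ.Facet, F.1.card ≤ n) :
    ringKrullDim (MvPolynomial E.Vertex K ⧸ E.binomialIdeal K) ≤ n := by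
  refine ringKrullDim_le_of_forall_quotient_prime fun P hP => ?_
  let A := (MvPolynomial E.Vertex K ⧸ E.binomialIdeal K) ⧸ P
  let L := FractionRing A
  let ψ : MvPolynomial E.Vertex K →ₐ[K] A :=
    (Ideal.Quotient.mkₐ K P).comp (Ideal.Quotient.mkₐ K (E.binomialIdeal K))
  have hψ : Function.Surjective ψ :=
    (Ideal.Quotient.mkₐ_surjective K P).comp (Ideal.Quotient.mkₐ_surjective K _)
  -- The generic point of the subvariety defined by `P`.
  let a : E.Vertex → L := fun v => algebraMap A L (ψ (MvPolynomial.X v))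
  have haeval : MvPolynomial.aeval a = (IsScalarTower.toAlgHom K A L).comp ψ :=
    MvPolynomial.algHom_ext fun v => by simp [a]
  have ha : E.IsZero a := by
    rw [← E.binomialIdeal_le_ker_aeval_iff (K := K) a]
    intro p hp
    have : ψ p = 0 := by
      simp [ψ, Ideal.Quotient.eq_zero_iff_mem.mpr hp]
    rw [RingHom.mem_ker, haeval, AlgHom.comp_apply, this, map_zero]
  obtain ⟨F, T, hT, hcard, halg⟩ := ha.exists_finite_forall_isAlgebraic (K := K)
  have : Algebra.FiniteType K A := .of_surjective ψ hψ
  have hgen : Algebra.adjoin K (Set.range fun v => ψ (MvPolynomial.X v)) = ⊤ := by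
    rw [Set.range_comp' ψ, ← AlgHom.map_adjoin, MvPolynomial.adjoin_range_X, Algebra.map_top,
      AlgHom.range_eq_top]
    exact hψ
  refine (ringKrullDim_le_ncard_of_forall_isAlgebraic (A := A) (L := L) hgen hT ?_).trans ?_
  · rintro _ ⟨v, rfl⟩
    exact halg v
  · exact_mod_cast hcard.trans (hn F)

end ExtensionData

/-- The dimension of a finite complex is attained on a facet of maximal cardinality. -/
theorem exists_facet_forall_card_le {V : Type*} [Finite V] [Nonempty V]
    (Δ : AbstractSimplicialComplex V) :
    ∃ F : Δ.Facet, (∀ S ∈ Δ.faces, S.card ≤ F.1.card) ∧ Δ.dim + 1 = F.1.card := by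
  obtain ⟨F, hF, hmax⟩ := (Set.toFinite Δ.faces).exists_maximalFor Finset.card Δ.faces
    ⟨_, Δ.singleton_mem (Classical.arbitrary V)⟩
  have hle (S) (hS : S ∈ Δ.faces) : S.card ≤ F.card := by
    by_contra! h
    exact h.not_ge (hmax hS h.le)
  refine ⟨⟨F, hF, fun S hS hFS => (Finset.eq_of_subset_of_card_le hFS (hle S hS)).ge⟩, hle, ?_⟩
  have hpos : 0 < F.card := (Finset.card_pos.mpr (Finset.singleton_nonempty _)).trans_le
    (hle _ (Δ.singleton_mem (Classical.arbitrary V)))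
  have hdim : Δ.dim = (F.card - 1 : ℕ) := by
    refine le_antisymm (iSup₂_le fun S hS => ?_) (le_iSup₂_of_le F hF le_rfl)
    exact_mod_cast Nat.sub_le_sub_right (hle S hS) 1
  rw [hdim]
  exact_mod_cast Nat.sub_add_cancel hpos

end AbstractSimplicialComplex

theorem mainTheorem4 {K : Type*} [Field K] {V : Type*} [Finite V] [Nonempty V]
    (Δ : AbstractSimplicialComplex V) (E : Δ.ExtensionData) :
    ringKrullDim (MvPolynomial E.Vertex K ⧸ E.binomialIdeal K) = 1 + (Δ.dim : WithBot ℕ∞) := by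
  obtain ⟨F, hle, hdim⟩ := Δ.exists_facet_forall_card_le
  have h : 1 + (Δ.dim : WithBot ℕ∞) = (F.1.card : WithBot ℕ∞) := by
    rw [add_comm]
    exact_mod_cast congrArg (fun d : ℕ∞ => (d : WithBot ℕ∞)) hdim
  rw [h]
  exact le_antisymm (E.ringKrullDim_le K fun G => hle _ G.2.prop) (E.card_le_ringKrullDim K F)
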